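/- Let $\theta>0$ and $\mu\in\mathbb R$, and let $G=(G_t)_{t\ge 0}$ be a centered Gaussian process with almost surely continuous paths such that $G_0=0$ almost surely and, for some constants $c>0$ and $\gamma\in(0,1)$, $$E\big[(G_t-G_s)^2\big]\le c\,|t-s|^{2\gamma}\qquad\text{for all } s,t\ge 0 .$$ (By the Kolmogorov–Centsov theorem, every process satisfying this bound has a modification with continuous paths.) Let $X=(X_t)_{t\ge0}$ be the pathwise solution with continuous paths of $$X_0=0,\qquad dX_t=\theta(\mu+X_t)\,dt+dG_t,\quad t\ge 0,$$ that is, almost surely $X_t=\int_0^t\theta(\mu+X_s)\,ds+G_t$ for all $t\ge0$. Put $\zeta_\infty=\theta\int_0^\infty e^{-\theta s}G_s\,ds$ and exclude the degenerate case in which $\mu=0$ and $\zeta_\infty=0$ almost surely (as happens, for example, when $\mu=0$ and $G\equiv0$, hence $X\equiv 0$). For $T\ge0$ define $$\widetilde\theta_T=\frac{\frac12TX_T^2-X_T\int_0^TX_s\,ds}{T\int_0^TX_s^2\,ds-\left(\int_0^TX_s\,ds\right)^2},\qquad \widetilde\mu_T=\frac{\int_0^TX_s^2\,ds-\frac12X_T\int_0^TX_s\,ds}{\frac12TX_T-\int_0^TX_s\,ds},$$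 $$\widetilde\alpha_T=\frac{X_T\int_0^TX_s^2\,ds-\frac12X_T^2\int_0^TX_s\,ds}{T\int_0^TX_s^2\,ds-\left(\int_0^TX_s\,ds\right)^2}.$$ Then almost surely these denominators are nonzero for all sufficiently large $T$, and $$\widetilde\theta_T\longrightarrow\theta,\qquad \widetilde\mu_T\longrightarrow\mu\qquad\text{almost surely as }T\to\infty .$$ Consequently, almost surely $\widetilde\alpha_T=\widetilde\theta_T\,\widetilde\mu_T$ for all sufficiently large $T$, and $\widetilde\alpha_T\to\theta\mu$ almost surely as $T\to\infty$. -/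

import Mathlib

open MeasureTheory ProbabilityTheory Filter Topology
open scoped NNReal

noncomputable section

namespace Vasicek

/-- `G` is a centered Gaussian process indexed by `[0, ∞)` such that `G 0 = 0` almost surely and,
for some constants `c > 0` and `γ ∈ (0, 1)`, `E (G t - G s) ^ 2 ≤ c * |t - s| ^ (2 * γ)` for all
`s, t ≥ 0`. -/
structure AssumptionA1 {Ω : Type*} [MeasurableSpace Ω] (G : ℝ≥0 → Ω → ℝ) (P : Measure Ω) :
    Prop where
  gaussian : IsGaussianProcess G P
  centered : ∀ t, ∫ ω, G t ω ∂P = 0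
  zero : ∀ᵐ ω ∂P, G 0 ω = 0
  increments : ∃ c γ : ℝ, 0 < c ∧ 0 < γ ∧ γ < 1 ∧
    ∀ s t : ℝ≥0, ∫ ω, (G t ω - G s ω) ^ 2 ∂P ≤ c * |(t : ℝ) - (s : ℝ)| ^ (2 * γ)

/-- The integral `∫₀ᵀ f(s) ds` of a path `f : [0, ∞) → ℝ`. -/
def pathIntegral (f : ℝ≥0 → ℝ) (T : ℝ≥0) : ℝ :=
  ∫ s in (0 : ℝ)..(T : ℝ), f s.toNNReal

/-- The continuous path `x` solves `x(0) = 0`, `dx(t) = θ (μ + x(t)) dt + dg(t)`, `t ≥ 0`, for the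
driving path `g` (with `g(0) = 0`), in integrated form. -/
structure IsSolution (θ μ : ℝ) (g x : ℝ≥0 → ℝ) : Prop where
  continuous : Continuous x
  init : x 0 = 0
  eq : ∀ t, x t = pathIntegral (fun s => θ * (μ + x s)) t + g t

/-- `ζ_∞ = θ ∫₀^∞ e^{-θ s} g(s) ds` for a driving path `g`. -/
def zetaInfty (θ : ℝ) (g : ℝ≥0 → ℝ) : ℝ :=
  θ * ∫ s in Set.Ioi (0 : ℝ), Real.exp (-θ * s) * g s.toNNReal

/-- The common denominator `T ∫₀ᵀ x² ds - (∫₀ᵀ x ds)²` of `θ̃_T` and `α̃_T`. -/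
def denomTheta (x : ℝ≥0 → ℝ) (T : ℝ≥0) : ℝ :=
  (T : ℝ) * pathIntegral (fun s => x s ^ 2) T - pathIntegral x T ^ 2

/-- The denominator `½ T x_T - ∫₀ᵀ x ds` of `μ̃_T`. -/
def denomMu (x : ℝ≥0 → ℝ) (T : ℝ≥0) : ℝ :=
  1 / 2 * (T : ℝ) * x T - pathIntegral x T

/-- The estimator `θ̃_T`, computed from the observed path `x`. -/
def thetaTilde (x : ℝ≥0 → ℝ) (T : ℝ≥0) : ℝ :=
  (1 / 2 * (T : ℝ) * x T ^ 2 - x T * pathIntegral x T) / denomTheta x T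

/-- The estimator `α̃_T`, computed from the observed path `x`. -/
def alphaTilde (x : ℝ≥0 → ℝ) (T : ℝ≥0) : ℝ :=
  (x T * pathIntegral (fun s => x s ^ 2) T - 1 / 2 * x T ^ 2 * pathIntegral x T) / denomTheta x T

/-- The estimator `μ̃_T`, computed from the observed path `x`. -/
def muTilde (x : ℝ≥0 → ℝ) (T : ℝ≥0) : ℝ :=
  (pathIntegral (fun s => x s ^ 2) T - 1 / 2 * x T * pathIntegral x T) / denomMu x T

end Vasicek

end

/-! Everything is pathwise once two almost sure facts about `G` are known: `G t = o(t)`, and `L = μ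
+ ζ_∞` is nonzero.

Given these, the integrating factor `e^{-θt}` shows that `∫ X ~ (L/θ) e^{θt}`, hence `X ~ L e^{θt}`
and `∫ X² ~ (L²/2θ) e^{2θt}`. The denominators of `θ̃` and `μ̃` are then equivalent to `(L²/2θ) T
e^{2θT}` and `(L/2) T e^{θT}`. The numerator of `θ̃` is `X_T` times the denominator of `μ̃`, so `θ̃
→ θ`. In the numerator of `μ̃` the terms of order `e^{2θT}` cancel. The energy identity
`integral_sq_eq` makes this exact and leaves `μ T X_T / 2` up to `o(T e^{θT})`, so `μ̃ → μ`.

Sublinear growth comes from Gaussian moments of high order and dyadic chaining on each `[n, n+1]`,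
where `γ < 1` makes the bounds summable in `n` (`ae_tendsto_div_of_moment_bound`). As an almost sure
limit of centered Gaussians, `ζ_∞` is Gaussian: either it has no atoms, or it vanishes almost surely
and then `L = μ ≠ 0`. -/

namespace Vasicek

open Asymptotics Set

/-! ### Calculus at infinity and exponential weights -/

/-- A form of L'Hôpital's rule at infinity: little-o relations may be integrated. -/
theorem isLittleO_of_hasDerivAt {F F' φ φ' : ℝ → ℝ} (hF : ∀ t, HasDerivAt F (F' t) t)
    (hφ : ∀ t, HasDerivAt φ (φ' t) t) (hpos : ∀ᶠ t in atTop, 0 < φ' t)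
    (htop : Tendsto φ atTop atTop) (h : F' =o[atTop] φ') : F =o[atTop] φ := by
  rw [isLittleO_iff]
  intro ε hε
  have h2 := (isLittleO_iff.1 h) (half_pos hε)
  obtain ⟨a, ha⟩ := eventually_atTop.1 (h2.and hpos)
  have key : ∀ t, a ≤ t → |F t - F a| ≤ ε / 2 * (φ t - φ a) := by
    intro t hat
    have := image_norm_le_of_norm_deriv_right_le_deriv_boundary (f := fun s => F s - F a)
      (f' := F') (a := a) (b := t) (B := fun s => ε / 2 * (φ s - φ a))
      (B' := fun s => ε / 2 * φ' s)
      (fun s _ => ((hF s).sub_const _).continuousAt.continuousWithinAt)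
      (fun s _ => ((hF s).sub_const _).hasDerivWithinAt) (by simp)
      (fun s => ((hφ s).sub_const _).const_mul _)
      (fun s hs => by
        have := ha s hs.1
        simpa [Real.norm_eq_abs, abs_of_pos this.2] using this.1)
    simpa using this ⟨hat, le_rfl⟩
  -- Beyond the last threshold the constants left by the base point `a` are absorbed by the other
  -- half of `ε * φ t`.
  filter_upwards [eventually_ge_atTop a, htop.eventually_ge_atTop 0,
    htop.eventually_ge_atTop ((|F a| + ε / 2 * |φ a|) / (ε / 2))] with t h1 h3 h4
  have h5 := key t h1
  rw [div_le_iff₀ (half_pos hε)] at h4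
  rw [Real.norm_eq_abs, Real.norm_eq_abs, abs_of_nonneg h3]
  have h6 : |F t| ≤ |F t - F a| + |F a| := by
    simpa using abs_add_le (F t - F a) (F a)
  have h7 := neg_abs_le (φ a)
  nlinarith

theorem tendsto_div_of_hasDerivAt {F F' φ φ' : ℝ → ℝ} {l : ℝ} (hF : ∀ t, HasDerivAt F (F' t) t)
    (hφ : ∀ t, HasDerivAt φ (φ' t) t) (hpos : ∀ᶠ t in atTop, 0 < φ' t)
    (htop : Tendsto φ atTop atTop) (h : Tendsto (fun t => F' t / φ' t) atTop (𝓝 l)) :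
    Tendsto (fun t => F t / φ t) atTop (𝓝 l) := by
  have h1 : (fun t => F' t - l * φ' t) =o[atTop] φ' := by
    rw [isLittleO_iff_tendsto' (hpos.mono fun t ht h0 => absurd h0 ht.ne')]
    have := h.sub_const l
    rw [sub_self] at this
    refine this.congr' (hpos.mono fun t ht => ?_)
    have := ht.ne'
    field_simp
  have h2 := isLittleO_of_hasDerivAt (fun t => (hF t).sub ((hφ t).const_mul l)) hφ hpos htop h1
  have h3 := h2.tendsto_div_nhds_zero.add_const l
  rw [zero_add] at h3
  refine h3.congr' ((htop.eventually_gt_atTop 0).mono fun t ht => ?_)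
  have := ht.ne'
  simp only [Pi.sub_apply]
  field_simp
  ring

theorem hasDerivAt_exp_mul (a t : ℝ) :
    HasDerivAt (fun t => Real.exp (a * t)) (a * Real.exp (a * t)) t := by
  simpa [mul_comm] using ((hasDerivAt_id t).const_mul a).exp

theorem tendsto_exp_mul_atTop {a : ℝ} (ha : 0 < a) :
    Tendsto (fun t => Real.exp (a * t)) atTop atTop :=
  Real.tendsto_exp_atTop.comp (tendsto_id.const_mul_atTop ha)

theorem tendsto_id_div_exp_mul {a : ℝ} (ha : 0 < a) :
    Tendsto (fun t => t / Real.exp (a * t)) atTop (𝓝 0) := by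
  have := Real.tendsto_pow_mul_exp_neg_atTop_nhds_zero 1
  have := (this.comp (tendsto_id.const_mul_atTop ha)).const_mul (1 / a)
  rw [mul_zero] at this
  refine this.congr fun t => ?_
  simp only [Function.comp, id, Real.exp_neg]
  field_simp

theorem tendsto_div_exp_mul {g : ℝ → ℝ} (hg0 : Tendsto (fun t => g t / t) atTop (𝓝 0))
    {a : ℝ} (ha : 0 < a) : Tendsto (fun t => g t / Real.exp (a * t)) atTop (𝓝 0) := by
  have := hg0.mul (tendsto_id_div_exp_mul ha)
  rw [mul_zero] at this
  refine this.congr' ((eventually_gt_atTop 0).mono fun t ht => ?_)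
  have := ht.ne'
  field_simp

/-- Half of the decay rate is spent on absorbing the linear growth. -/
theorem isBigO_exp_neg_mul_of_isBigO_id {g : ℝ → ℝ} (hg0 : g =O[atTop] fun t => t)
    {a : ℝ} (ha : 0 < a) :
    (fun s => Real.exp (-a * s) * g s) =O[atTop] fun s => Real.exp (-(a / 2) * s) := by
  have h1 : (fun t : ℝ => t) =O[atTop] fun t => Real.exp (a / 2 * t) :=
    (isLittleO_of_tendsto (fun t h => absurd h (Real.exp_pos _).ne')
      (tendsto_id_div_exp_mul (half_pos ha))).isBigO
  refine ((isBigO_refl (fun s => Real.exp (-a * s)) atTop).mul (hg0.trans h1)).congr_right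
    fun s => ?_
  rw [← Real.exp_add]
  ring_nf

theorem integrableOn_exp_neg_mul {g : ℝ → ℝ} (hg : Continuous g) (hg0 : g =O[atTop] fun t => t)
    {a : ℝ} (ha : 0 < a) : IntegrableOn (fun s => Real.exp (-a * s) * g s) (Ioi 0) :=
  integrable_of_isBigO_exp_neg (half_pos ha) (by fun_prop) (isBigO_exp_neg_mul_of_isBigO_id hg0 ha)

theorem integral_exp_neg_mul_id {a : ℝ} (ha : 0 < a) :
    ∫ s in Ioi (0 : ℝ), Real.exp (-a * s) * s = 1 / a ^ 2 := by
  have := Real.integral_rpow_mul_exp_neg_mul_Ioi (a := 2) (r := a) (by norm_num) ha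
  rw [Real.Gamma_two] at this
  rw [show (1 : ℝ) / a ^ 2 = (1 / a) ^ (2 : ℝ) * 1 by
    rw [Real.rpow_two, mul_one]; field_simp, ← this]
  refine setIntegral_congr_fun measurableSet_Ioi fun s _ => ?_
  norm_num
  ring

theorem hasDerivAt_integral {f : ℝ → ℝ} (hf : Continuous f) (t : ℝ) :
    HasDerivAt (fun t => ∫ s in (0 : ℝ)..t, f s) (f t) t :=
  intervalIntegral.integral_hasDerivAt_right (hf.intervalIntegrable _ _)
    hf.aestronglyMeasurable.stronglyMeasurableAtFilter hf.continuousAt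

/-! ### Deterministic asymptotics of a solution -/

/-- A path on the line which solves the Vasicek equation on `[0, ∞)`, driven by a path of
sublinear growth. -/
structure SublinearSolution (θ μ : ℝ) (g x : ℝ → ℝ) : Prop where
  pos : 0 < θ
  continuous_drive : Continuous g
  continuous : Continuous x
  growth : Tendsto (fun t => g t / t) atTop (𝓝 0)
  eq : ∀ t, 0 ≤ t → x t = θ * μ * t + θ * (∫ s in (0 : ℝ)..t, x s) + g t

namespace SublinearSolution

variable {θ μ : ℝ} {g x : ℝ → ℝ}

theorem isLittleO (h : SublinearSolution θ μ g x) : g =o[atTop] fun t => t :=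
  (isLittleO_iff_tendsto' ((eventually_gt_atTop 0).mono fun _ ht h0 => absurd h0 ht.ne')).2
    h.growth

/-- The integrating factor is applied to `∫ x`, since `x` need not be differentiable: the derivative
of `e^{-θs} ∫₀ˢ x` is `e^{-θs} (θ μ s + g s)`, which is integrable on the half-line. -/
theorem tendsto_integral (h : SublinearSolution θ μ g x) :
    Tendsto (fun t => (∫ s in (0 : ℝ)..t, x s) / Real.exp (θ * t)) atTop
      (𝓝 ((μ + θ * ∫ s in Ioi (0 : ℝ), Real.exp (-θ * s) * g s) / θ)) := by
  have hθ := h.pos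
  have hg := h.continuous_drive
  have hx := h.continuous
  have hbig : (fun t => θ * μ * t + g t) =O[atTop] fun t => t :=
    (isBigO_const_mul_self _ _ _).add h.isLittleO.isBigO
  have hlim := intervalIntegral_tendsto_integral_Ioi 0
    (integrableOn_exp_neg_mul (by fun_prop) hbig hθ) tendsto_id
  have hval : ∫ s in Ioi (0 : ℝ), Real.exp (-θ * s) * (θ * μ * s + g s) =
      (μ + θ * ∫ s in Ioi (0 : ℝ), Real.exp (-θ * s) * g s) / θ := by
    have e1 : ∀ s, Real.exp (-θ * s) * (θ * μ * s + g s) =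
        θ * μ * (Real.exp (-θ * s) * s) + Real.exp (-θ * s) * g s := fun s => by ring
    simp_rw [e1]
    rw [integral_add
      ((integrableOn_exp_neg_mul (g := fun s => s) continuous_id (isBigO_refl _ _) hθ).const_mul _)
      (integrableOn_exp_neg_mul hg h.isLittleO.isBigO hθ), integral_const_mul,
      integral_exp_neg_mul_id hθ]
    field_simp
  rw [hval] at hlim
  refine hlim.congr' ((eventually_ge_atTop 0).mono fun t ht => ?_)
  have hderiv : ∀ s, HasDerivAt (fun s => Real.exp (-θ * s) * ∫ u in (0 : ℝ)..s, x u)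
      (-θ * Real.exp (-θ * s) * (∫ u in (0 : ℝ)..s, x u) + Real.exp (-θ * s) * x s) s :=
    fun s => (hasDerivAt_exp_mul (-θ) s).mul (hasDerivAt_integral hx s)
  have hcI : Continuous fun s => ∫ u in (0 : ℝ)..s, x u :=
    continuous_iff_continuousAt.2 fun s => (hasDerivAt_integral hx s).continuousAt
  have hftc := intervalIntegral.integral_eq_sub_of_hasDerivAt (a := 0) (b := t)
    (fun s _ => hderiv s) (Continuous.intervalIntegrable (by fun_prop) _ _)
  simp only [intervalIntegral.integral_same, mul_zero, sub_zero] at hftc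
  beta_reduce
  rw [div_eq_mul_inv, ← Real.exp_neg, mul_comm (∫ s in (0 : ℝ)..t, x s), ← neg_mul, ← hftc]
  refine intervalIntegral.integral_congr fun s hs => ?_
  rw [id, uIcc_of_le ht] at hs
  rw [h.eq s hs.1]
  ring

theorem tendsto_path (h : SublinearSolution θ μ g x) :
    Tendsto (fun t => x t / Real.exp (θ * t)) atTop
      (𝓝 (μ + θ * ∫ s in Ioi (0 : ℝ), Real.exp (-θ * s) * g s)) := by
  have hθ := h.pos
  have := (((tendsto_id_div_exp_mul hθ).const_mul (θ * μ)).add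
    (h.tendsto_integral.const_mul θ)).add (tendsto_div_exp_mul h.growth hθ)
  rw [mul_zero, zero_add, add_zero, mul_div_cancel₀ _ hθ.ne'] at this
  refine this.congr' ((eventually_ge_atTop 0).mono fun t ht => ?_)
  beta_reduce
  rw [h.eq t ht]
  ring

theorem tendsto_integral_sq (h : SublinearSolution θ μ g x) :
    Tendsto (fun t => (∫ s in (0 : ℝ)..t, x s ^ 2) / Real.exp (θ * t) ^ 2) atTop
      (𝓝 ((μ + θ * ∫ s in Ioi (0 : ℝ), Real.exp (-θ * s) * g s) ^ 2 / (2 * θ))) := by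
  have hθ := h.pos
  have hx := h.continuous
  have h2 : 0 < 2 * θ := by positivity
  have e : ∀ t, Real.exp (θ * t) ^ 2 = Real.exp (2 * θ * t) := fun t => by
    rw [← Real.exp_nat_mul]; push_cast; ring_nf
  simp_rw [e]
  refine tendsto_div_of_hasDerivAt (hasDerivAt_integral (by fun_prop)) (hasDerivAt_exp_mul _)
    (Eventually.of_forall fun t => by positivity) (tendsto_exp_mul_atTop h2) ?_
  refine ((h.tendsto_path.pow 2).div_const (2 * θ)).congr fun t => ?_
  rw [← e]
  field_simp

/-- By L'Hôpital: the integrand is `o(t) * O(e^{θt})`, and the derivative of `t e^{θt}` is `(1 + θt)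
e^{θt}`. -/
theorem tendsto_integral_drive (h : SublinearSolution θ μ g x) :
    Tendsto (fun t => (∫ s in (0 : ℝ)..t, g s * (μ + x s)) / (t * Real.exp (θ * t))) atTop
      (𝓝 0) := by
  have hθ := h.pos
  have hx := h.continuous
  have hg := h.continuous_drive
  refine tendsto_div_of_hasDerivAt (hasDerivAt_integral (by fun_prop))
    (fun t => (hasDerivAt_id t).mul (hasDerivAt_exp_mul θ t))
    ((eventually_gt_atTop 0).mono fun t ht => by simp only [id]; positivity)
    (tendsto_id.atTop_mul_atTop₀ (tendsto_exp_mul_atTop hθ)) ?_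
  have h1 : Tendsto (fun t => (μ + x t) / Real.exp (θ * t)) atTop
      (𝓝 (0 + (μ + θ * ∫ s in Ioi (0 : ℝ), Real.exp (-θ * s) * g s))) := by
    refine (((tendsto_const_nhds (x := μ)).div_atTop (tendsto_exp_mul_atTop hθ)).add h.tendsto_path).congr
      fun t => ?_
    exact (add_div _ _ _).symm
  have h3 : Tendsto (fun t : ℝ => 1 / t + θ) atTop (𝓝 (0 + θ)) :=
    (tendsto_const_nhds.div_atTop tendsto_id).add_const θ
  rw [zero_add] at h3
  have := (h.growth.mul h1).div h3 hθ.ne'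
  rw [zero_mul, zero_div] at this
  refine this.congr' ((eventually_gt_atTop 0).mono fun t ht => ?_)
  simp only [id, Pi.div_apply]
  have : (1 / t + θ) ≠ 0 := by positivity
  have : (1 + t * θ) ≠ 0 := by positivity
  field_simp

/-- The energy identity obtained by integrating the derivative of `(x - g) ^ 2`. -/
theorem integral_sq_eq (h : SublinearSolution θ μ g x) {t : ℝ} (ht : 0 ≤ t) :
    θ * (∫ s in (0 : ℝ)..t, x s ^ 2) = (x t - g t) ^ 2 / 2 - θ * μ * (∫ s in (0 : ℝ)..t, x s)
      + θ * ∫ s in (0 : ℝ)..t, g s * (μ + x s) := by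
  have hx := h.continuous
  have hg := h.continuous_drive
  have hcI : Continuous fun s => ∫ u in (0 : ℝ)..s, x u :=
    continuous_iff_continuousAt.2 fun s => (hasDerivAt_integral hx s).continuousAt
  -- For `s ≥ 0` the function squared is `x - g`, which is differentiable although `x` and `g` need
  -- not be.
  have hderiv : ∀ s, HasDerivAt (fun s => (θ * μ * s + θ * ∫ u in (0 : ℝ)..s, x u) ^ 2 / 2)
      ((θ * μ * s + θ * ∫ u in (0 : ℝ)..s, x u) * (θ * μ + θ * x s)) s := by
    intro s
    have := ((((hasDerivAt_id s).const_mul (θ * μ)).add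
      ((hasDerivAt_integral hx s).const_mul θ)).pow 2).div_const 2
    refine this.congr_deriv ?_
    simp only [Pi.add_apply, id]
    push_cast
    ring
  have hftc := intervalIntegral.integral_eq_sub_of_hasDerivAt (a := 0) (b := t)
    (fun s _ => hderiv s) (Continuous.intervalIntegrable (by fun_prop) _ _)
  have e : ∫ s in (0 : ℝ)..t, (θ * μ * s + θ * ∫ u in (0 : ℝ)..s, x u) * (θ * μ + θ * x s) =
      ∫ s in (0 : ℝ)..t, (θ * μ * x s + θ * x s ^ 2 - θ * (g s * (μ + x s))) := by
    refine intervalIntegral.integral_congr fun s hs => ?_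
    rw [uIcc_of_le ht] at hs
    rw [show θ * μ * s + θ * ∫ u in (0 : ℝ)..s, x u = x s - g s by rw [h.eq s hs.1]; ring]
    ring
  rw [e, intervalIntegral.integral_sub (Continuous.intervalIntegrable (by fun_prop) _ _)
    (Continuous.intervalIntegrable (by fun_prop) _ _),
    intervalIntegral.integral_add (Continuous.intervalIntegrable (by fun_prop) _ _)
    (Continuous.intervalIntegrable (by fun_prop) _ _)] at hftc
  simp only [intervalIntegral.integral_const_mul, intervalIntegral.integral_same] at hftc
  rw [show θ * μ * t + θ * ∫ u in (0 : ℝ)..t, x u = x t - g t by rw [h.eq t ht]; ring] at hftc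
  linarith

variable (h : SublinearSolution θ μ g x)
  (hL : μ + θ * ∫ s in Ioi (0 : ℝ), Real.exp (-θ * s) * g s ≠ 0)

include h

/-- The squared integral is only `O(e^{2θt})`, so the extra factor `t` of the other term dominates
it. -/
theorem tendsto_denomTheta :
    Tendsto (fun t => (t * (∫ s in (0 : ℝ)..t, x s ^ 2) - (∫ s in (0 : ℝ)..t, x s) ^ 2) /
      (t * Real.exp (θ * t) ^ 2)) atTop
      (𝓝 ((μ + θ * ∫ s in Ioi (0 : ℝ), Real.exp (-θ * s) * g s) ^ 2 / (2 * θ))) := by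
  have := h.tendsto_integral_sq.sub ((h.tendsto_integral.pow 2).mul
    (tendsto_const_nhds.div_atTop tendsto_id : Tendsto (fun t : ℝ => 1 / t) atTop (𝓝 0)))
  rw [mul_zero, sub_zero] at this
  refine this.congr' ((eventually_gt_atTop 0).mono fun t ht => ?_)
  have := ht.ne'
  field_simp

theorem tendsto_denomMu :
    Tendsto (fun t => (1 / 2 * t * x t - ∫ s in (0 : ℝ)..t, x s) / (t * Real.exp (θ * t))) atTop
      (𝓝 ((μ + θ * ∫ s in Ioi (0 : ℝ), Real.exp (-θ * s) * g s) / 2)) := by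
  have := (h.tendsto_path.div_const 2).sub (h.tendsto_integral.mul
    (tendsto_const_nhds.div_atTop tendsto_id : Tendsto (fun t : ℝ => 1 / t) atTop (𝓝 0)))
  rw [mul_zero, sub_zero] at this
  refine this.congr' ((eventually_gt_atTop 0).mono fun t ht => ?_)
  have := ht.ne'
  field_simp

/-- Substituting the energy identity and the equation for `∫ x` turns the numerator into `-g (x - g)
/ (2θ) + μ t x / 2 - μ ∫ x + ∫ g (μ + x)`. Only the second term survives at scale `t e^{θt}`. -/
theorem tendsto_numMu :
    Tendsto (fun t => ((∫ s in (0 : ℝ)..t, x s ^ 2) - 1 / 2 * x t * ∫ s in (0 : ℝ)..t, x s) /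
      (t * Real.exp (θ * t))) atTop
      (𝓝 (μ * ((μ + θ * ∫ s in Ioi (0 : ℝ), Real.exp (-θ * s) * g s) / 2))) := by
  have hθ := h.pos
  have hinv : Tendsto (fun t : ℝ => 1 / t) atTop (𝓝 0) := tendsto_const_nhds.div_atTop tendsto_id
  have hy := h.tendsto_path.sub (tendsto_div_exp_mul h.growth hθ)
  have := ((((hy.mul h.growth).const_mul (-(1 / (2 * θ)))).add
    (h.tendsto_path.const_mul (μ / 2))).sub
    ((h.tendsto_integral.mul hinv).const_mul μ)).add h.tendsto_integral_drive
  have hl : -(1 / (2 * θ)) *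
      ((μ + θ * (∫ s in Ioi (0 : ℝ), Real.exp (-θ * s) * g s) - 0) * 0) +
      μ / 2 * (μ + θ * ∫ s in Ioi (0 : ℝ), Real.exp (-θ * s) * g s) -
      μ * ((μ + θ * ∫ s in Ioi (0 : ℝ), Real.exp (-θ * s) * g s) / θ * 0) + 0 =
      μ * ((μ + θ * ∫ s in Ioi (0 : ℝ), Real.exp (-θ * s) * g s) / 2) := by ring
  rw [← hl]
  refine this.congr' ((eventually_gt_atTop 0).mono fun t ht => ?_)
  beta_reduce
  have e1 := h.integral_sq_eq ht.le
  have e2 := h.eq t ht.le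
  set Q := ∫ s in (0 : ℝ)..t, x s ^ 2
  set D := ∫ s in (0 : ℝ)..t, g s * (μ + x s)
  set J := ∫ s in (0 : ℝ)..t, x s
  have hQ : Q = ((x t - g t) ^ 2 / 2 - θ * μ * J + θ * D) / θ := by
    rw [← e1]; field_simp
  have hJ : J = (x t - g t - θ * μ * t) / θ := by
    rw [e2]; field_simp; ring
  rw [hQ]
  have hxJ : x t * J = x t * ((x t - g t - θ * μ * t) / θ) := by rw [← hJ]
  have : ((x t - g t) ^ 2 / 2 - θ * μ * J + θ * D) / θ - 1 / 2 * x t * J =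
      ((x t - g t) ^ 2 / 2 - θ * μ * J + θ * D) / θ
        - 1 / 2 * (x t * ((x t - g t - θ * μ * t) / θ)) := by
    rw [← hxJ]; ring
  rw [this]
  field_simp
  ring

include hL

theorem eventually_denom_ne_zero :
    ∀ᶠ t in atTop, t * (∫ s in (0 : ℝ)..t, x s ^ 2) - (∫ s in (0 : ℝ)..t, x s) ^ 2 ≠ 0 ∧
      1 / 2 * t * x t - ∫ s in (0 : ℝ)..t, x s ≠ 0 := by
  have hθ := h.pos
  filter_upwards [h.tendsto_denomTheta.eventually_ne (by positivity),
    h.tendsto_denomMu.eventually_ne (by positivity)] with t h1 h2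
  exact ⟨(div_ne_zero_iff.1 h1).1, (div_ne_zero_iff.1 h2).1⟩

theorem tendsto_thetaTilde :
    Tendsto (fun t => (1 / 2 * t * x t ^ 2 - x t * ∫ s in (0 : ℝ)..t, x s) /
      (t * (∫ s in (0 : ℝ)..t, x s ^ 2) - (∫ s in (0 : ℝ)..t, x s) ^ 2)) atTop (𝓝 θ) := by
  have hθ := h.pos
  -- The numerator is `x t` times the denominator of `μ̃`.
  have := (h.tendsto_path.mul h.tendsto_denomMu).div h.tendsto_denomTheta (by positivity)
  have hl : ∀ L : ℝ, L ≠ 0 → L * (L / 2) / (L ^ 2 / (2 * θ)) = θ := fun L hL => by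
    field_simp
  rw [hl _ hL] at this
  refine this.congr' ?_
  filter_upwards [eventually_gt_atTop 0, h.eventually_denom_ne_zero hL] with t ht hd
  have := hd.1
  simp only [Pi.div_apply]
  field_simp

theorem tendsto_muTilde :
    Tendsto (fun t => ((∫ s in (0 : ℝ)..t, x s ^ 2) - 1 / 2 * x t * ∫ s in (0 : ℝ)..t, x s) /
      (1 / 2 * t * x t - ∫ s in (0 : ℝ)..t, x s)) atTop (𝓝 μ) := by
  have := h.tendsto_numMu.div h.tendsto_denomMu (by positivity)
  rw [mul_div_cancel_right₀ _ (by positivity)] at this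
  refine this.congr' ?_
  filter_upwards [eventually_gt_atTop 0] with t ht
  simp only [Pi.div_apply]
  rw [div_div_div_cancel_right₀ (by positivity)]

end SublinearSolution

/-- Consistency along a single path. -/
theorem IsSolution.consistent {θ μ : ℝ} (hθ : 0 < θ) {g x : ℝ≥0 → ℝ} (hx : IsSolution θ μ g x)
    (hg : Continuous g) (hgrowth : Tendsto (fun t : ℝ => g t.toNNReal / t) atTop (𝓝 0))
    (hL : μ + zetaInfty θ g ≠ 0) :
    (∀ᶠ T in atTop, denomTheta x T ≠ 0 ∧ denomMu x T ≠ 0) ∧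
    Tendsto (thetaTilde x) atTop (𝓝 θ) ∧ Tendsto (muTilde x) atTop (𝓝 μ) := by
  have hxc : Continuous fun s : ℝ => x s.toNNReal := hx.continuous.comp continuous_real_toNNReal
  have hs : SublinearSolution θ μ (fun s => g s.toNNReal) (fun s => x s.toNNReal) := by
    refine ⟨hθ, hg.comp continuous_real_toNNReal, hxc, hgrowth, fun t ht => ?_⟩
    rw [hx.eq]
    unfold pathIntegral
    rw [Real.coe_toNNReal t ht]
    rw [intervalIntegral.integral_const_mul, intervalIntegral.integral_add
      (by simp) (hxc.intervalIntegrable _ _)]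
    simp
    ring
  have hcoe := NNReal.tendsto_coe_atTop.2 (tendsto_id (α := ℝ≥0) (x := atTop))
  refine ⟨(hcoe.eventually (hs.eventually_denom_ne_zero hL)).mono fun T hT => ?_,
    ((hs.tendsto_thetaTilde hL).comp hcoe).congr fun T => ?_,
    ((hs.tendsto_muTilde hL).comp hcoe).congr fun T => ?_⟩
  · simpa [denomTheta, denomMu, pathIntegral] using hT
  · simp [thetaTilde, denomTheta, pathIntegral]
  · simp [muTilde, denomMu, pathIntegral]

/-- The factor `denomMu` cancels. If `denomTheta` vanishes, both sides are zero by the convention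
for division. -/
theorem alphaTilde_eq {x : ℝ≥0 → ℝ} {T : ℝ≥0} (h : denomMu x T ≠ 0) :
    alphaTilde x T = thetaTilde x T * muTilde x T := by
  rw [alphaTilde, thetaTilde, muTilde,
    show 1 / 2 * (T : ℝ) * x T ^ 2 - x T * pathIntegral x T = x T * denomMu x T by
      rw [denomMu]; ring]
  field_simp

end Vasicek

/-! ### Gaussian limits and Riemann sums -/

namespace Vasicek

open Set
open scoped ENNReal

variable {Ω : Type*} [MeasurableSpace Ω] {P : Measure Ω}

/-- An almost sure limit of centered Gaussian variables is a centered Gaussian variable. -/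
theorem exists_map_eq_gaussianReal_of_tendsto [IsProbabilityMeasure P] {Z : ℕ → Ω → ℝ}
    {Y : Ω → ℝ} (hm : ∀ n, AEMeasurable (Z n) P)
    (hZ : ∀ n, ∃ v : ℝ≥0, P.map (Z n) = gaussianReal 0 v)
    (hlim : ∀ᵐ ω ∂P, Tendsto (fun n => Z n ω) atTop (𝓝 (Y ω))) :
    AEMeasurable Y P ∧ ∃ v : ℝ≥0, P.map Y = gaussianReal 0 v := by
  choose v hv using hZ
  have hY : AEMeasurable Y P := aemeasurable_of_tendsto_metrizable_ae atTop hm hlim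
  refine ⟨hY, ?_⟩
  have hprob : IsProbabilityMeasure (P.map Y) := Measure.isProbabilityMeasure_map hY
  have hchar : ∀ u : ℝ, Tendsto (fun n => Complex.exp (-(v n * u ^ 2 / 2 : ℝ))) atTop
      (𝓝 (charFun (P.map Y) u)) := by
    intro u
    have e : ∀ n, Complex.exp (-(v n * u ^ 2 / 2 : ℝ)) =
        ∫ ω, Complex.exp (u * Z n ω * Complex.I) ∂P := by
      intro n
      have := charFun_gaussianReal (μ := 0) (v := v n) u
      rw [← hv n, charFun_apply_real, integral_map (hm n) (by fun_prop)] at this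
      rw [this]
      push_cast
      congr 1
      ring
    simp_rw [e]
    rw [charFun_apply_real, integral_map hY (by fun_prop)]
    refine tendsto_integral_of_dominated_convergence (fun _ => 1)
      (fun n => ?_) (integrable_const _) (fun n => ?_) ?_
    · have := hm n
      exact (Measurable.comp_aemeasurable (g := fun x : ℝ => Complex.exp (u * x * Complex.I))
        (by fun_prop) this).aestronglyMeasurable
    · refine Eventually.of_forall fun ω => ?_
      rw [← Complex.ofReal_mul, Complex.norm_exp_ofReal_mul_I]
    · filter_upwards [hlim] with ω hω
      have hc : Continuous fun x : ℝ => Complex.exp (u * x * Complex.I) := by fun_prop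
      exact (hc.tendsto _).comp hω
  -- At a single such `u`, the logarithm of the modulus of the characteristic functions already
  -- forces the variances `v n` to converge.
  obtain ⟨u, hu0, hu⟩ : ∃ u : ℝ, u ≠ 0 ∧ charFun (P.map Y) u ≠ 0 := by
    have h0 : charFun (P.map Y) 0 ≠ 0 := by simp
    have h1 : ∀ᶠ u in 𝓝[≠] (0 : ℝ), charFun (P.map Y) u ≠ 0 :=
      (continuous_charFun.continuousAt.eventually_ne h0).filter_mono nhdsWithin_le_nhds
    obtain ⟨u, h2, h3⟩ := (h1.and self_mem_nhdsWithin).exists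
    exact ⟨u, h3, h2⟩
  have hnorm := (hchar u).norm
  simp only [← Complex.ofReal_neg, Complex.norm_exp_ofReal] at hnorm
  have hlog := (hnorm.log (norm_ne_zero_iff.2 hu)).const_mul (-(2 / u ^ 2))
  simp only [Real.log_exp] at hlog
  set w := -(2 / u ^ 2) * Real.log ‖charFun (P.map Y) u‖
  have hvw : Tendsto (fun n => (v n : ℝ)) atTop (𝓝 w) :=
    hlog.congr fun n => by field_simp
  have hw : 0 ≤ w := ge_of_tendsto' hvw fun n => (v n).2
  refine ⟨w.toNNReal, Measure.ext_of_charFun ?_⟩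
  ext s
  refine tendsto_nhds_unique (hchar s) ?_
  rw [charFun_gaussianReal, Real.coe_toNNReal w hw]
  have hc : Continuous fun a : ℝ => Complex.exp (-(a * s ^ 2 / 2 : ℝ)) := by fun_prop
  have := (hc.tendsto w).comp hvw
  convert this using 2
  push_cast
  congr 1
  simp

/-- Left Riemann sums of a continuous function converge to the integral. -/
theorem tendsto_riemann_sum {f : ℝ → ℝ} (hf : Continuous f) {b : ℝ} (hb : 0 ≤ b) :
    Tendsto (fun m : ℕ => ∑ k ∈ Finset.range m, b / m * f (k * (b / m))) atTop
      (𝓝 (∫ s in (0 : ℝ)..b, f s)) := by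
  rw [Metric.tendsto_atTop]
  intro ε hε
  have huc := isCompact_Icc.uniformContinuousOn_of_continuous
    (hf.continuousOn (s := Icc 0 b))
  rw [Metric.uniformContinuousOn_iff] at huc
  -- The total error is then at most `ε * b / (b + 1) < ε`, also when `b = 0`.
  obtain ⟨δ, hδ, hfδ⟩ := huc (ε / (b + 1)) (by positivity)
  obtain ⟨N, hN⟩ := exists_nat_gt (b / δ)
  refine ⟨N + 1, fun m hm => ?_⟩
  have hm0 : (0 : ℝ) < m := by exact_mod_cast (by omega : 0 < m)
  have hmesh : b / m < δ := by
    rw [div_lt_iff₀ hm0]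
    rw [div_lt_iff₀ hδ] at hN
    have : (N : ℝ) ≤ m := by exact_mod_cast (by omega : N ≤ m)
    nlinarith
  have hh : 0 ≤ b / m := by positivity
  have hsplit := intervalIntegral.sum_integral_adjacent_intervals (f := f) (μ := volume)
    (a := fun k : ℕ => (k : ℝ) * (b / m)) (n := m) fun k _ => hf.intervalIntegrable _ _
  simp only [Nat.cast_zero, zero_mul] at hsplit
  rw [mul_div_cancel₀ _ hm0.ne'] at hsplit
  rw [dist_comm, Real.dist_eq, ← hsplit, ← Finset.sum_sub_distrib]
  refine (Finset.abs_sum_le_sum_abs _ _).trans_lt ?_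
  have hterm : ∀ k ∈ Finset.range m,
      |(∫ s in (k : ℝ) * (b / m)..((k + 1 : ℕ) : ℝ) * (b / m), f s) - b / m * f (k * (b / m))| ≤
        ε / (b + 1) * (b / m) := by
    intro k hk
    have hk' : ((k + 1 : ℕ) : ℝ) ≤ m := by exact_mod_cast Finset.mem_range.1 hk
    have hle : (k : ℝ) * (b / m) ≤ ((k + 1 : ℕ) : ℝ) * (b / m) := by
      push_cast; nlinarith
    have hub : ((k + 1 : ℕ) : ℝ) * (b / m) ≤ b :=
      (mul_le_mul_of_nonneg_right hk' hh).trans_eq (mul_div_cancel₀ _ hm0.ne')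
    have hlb : 0 ≤ (k : ℝ) * (b / m) := by positivity
    have hconst : b / m * f (k * (b / m)) =
        ∫ _ in (k : ℝ) * (b / m)..((k + 1 : ℕ) : ℝ) * (b / m), f (k * (b / m)) := by
      rw [intervalIntegral.integral_const, smul_eq_mul]; push_cast; ring
    rw [hconst, ← intervalIntegral.integral_sub (hf.intervalIntegrable _ _)
      intervalIntegrable_const, ← Real.norm_eq_abs]
    refine (intervalIntegral.norm_integral_le_of_norm_le_const (C := ε / (b + 1)) ?_).trans_eq ?_
    · intro s hs
      rw [uIoc_of_le hle] at hs
      have hlen : ((k + 1 : ℕ) : ℝ) * (b / m) = k * (b / m) + b / m := by push_cast; ring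
      refine (hfδ s ⟨hlb.trans hs.1.le, hs.2.trans hub⟩ _ ⟨hlb, hle.trans hub⟩ ?_).le
      rw [Real.dist_eq, abs_of_nonneg (by linarith [hs.1])]
      linarith [hs.2]
    · rw [abs_of_nonneg (by linarith)]; push_cast; ring
  refine (Finset.sum_le_sum hterm).trans_lt ?_
  rw [Finset.sum_const, Finset.card_range, nsmul_eq_mul]
  have : (m : ℝ) * (ε / (b + 1) * (b / m)) = ε * (b / (b + 1)) := by field_simp
  rw [this]
  have : b / (b + 1) < 1 := by rw [div_lt_one (by positivity)]; linarith
  nlinarith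

/-! ### Gaussian moments, dyadic chaining and sublinear growth -/

theorem lintegral_enorm_pow_gaussianReal_lt_top (p : ℕ) :
    ∫⁻ x, ‖x‖ₑ ^ p ∂(gaussianReal 0 1) < ∞ := by
  rcases eq_or_ne p 0 with rfl | hp
  · simp
  have := (memLp_id_gaussianReal' (μ := 0) (v := 1) p (by simp)).eLpNorm_lt_top
  rw [eLpNorm_lt_top_iff_lintegral_rpow_enorm_lt_top (by simpa using hp) (by simp)] at this
  simpa using this

/-- The absolute moments of a centered Gaussian variable are controlled by its variance. -/
theorem lintegral_enorm_pow_le_of_hasGaussianLaw {Z : Ω → ℝ} (hZ : HasGaussianLaw Z P)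
    (h0 : ∫ ω, Z ω ∂P = 0) {s : ℝ} (hs : 0 ≤ s) (h2 : ∫ ω, Z ω ^ 2 ∂P ≤ s ^ 2) (p : ℕ) :
    ∫⁻ ω, ‖Z ω‖ₑ ^ p ∂P ≤ ENNReal.ofReal s ^ p * ∫⁻ x, ‖x‖ₑ ^ p ∂(gaussianReal 0 1) := by
  have hvar : Var[Z; P] = ∫ ω, Z ω ^ 2 ∂P := variance_of_integral_eq_zero hZ.aemeasurable h0
  have hvar0 : 0 ≤ Var[Z; P] := variance_nonneg _ _
  have hmap : P.map Z = (gaussianReal 0 1).map (√(Var[Z; P]) * ·) := by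
    rw [hZ.map_eq_gaussianReal, gaussianReal_map_const_mul, h0, mul_zero, mul_one]
    congr 1
    ext
    simp [Real.sq_sqrt hvar0, hvar0]
  calc ∫⁻ ω, ‖Z ω‖ₑ ^ p ∂P = ∫⁻ x, ‖x‖ₑ ^ p ∂(P.map Z) :=
        (lintegral_map' (f := fun x : ℝ => ‖x‖ₑ ^ p) (by fun_prop) hZ.aemeasurable).symm
    _ = ∫⁻ x, ‖√(Var[Z; P]) * x‖ₑ ^ p ∂(gaussianReal 0 1) := by
        rw [hmap, lintegral_map (by fun_prop) (by fun_prop)]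
    _ = ‖√(Var[Z; P])‖ₑ ^ p * ∫⁻ x, ‖x‖ₑ ^ p ∂(gaussianReal 0 1) := by
        simp_rw [enorm_mul, mul_pow]
        rw [lintegral_const_mul _ (by fun_prop)]
    _ ≤ _ := by
        gcongr
        rw [Real.enorm_eq_ofReal (Real.sqrt_nonneg _)]
        refine ENNReal.ofReal_le_ofReal (Real.sqrt_le_iff.2 ⟨hs, ?_⟩)
        rwa [hvar]

/-- Dyadic chaining on `[0, 1]`. -/
theorem abs_sub_le_of_dyadic_increments {f : ℝ → ℝ} (hf : Continuous f) {M r : ℝ} (hM : 0 ≤ M)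
    (hr0 : 0 ≤ r) (hr1 : r < 1)
    (h : ∀ k j : ℕ, j < 2 ^ k → |f ((j + 1) / 2 ^ k) - f (j / 2 ^ k)| ≤ M * r ^ k)
    {t : ℝ} (ht0 : 0 ≤ t) (ht1 : t ≤ 1) : |f t - f 0| ≤ M * (1 + (1 - r)⁻¹) := by
  let d : ℕ → ℝ := fun k => (⌊2 ^ k * t⌋₊ : ℝ) / 2 ^ k
  have hd : Tendsto d atTop (𝓝 t) := by
    have h2 : Tendsto (fun k : ℕ => (2 : ℝ) ^ k) atTop atTop :=
      tendsto_pow_atTop_atTop_of_one_lt one_lt_two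
    refine ((tendsto_nat_floor_mul_div_atTop ht0).comp h2).congr fun k => ?_
    simp only [Function.comp, d, mul_comm]
  have hstep : ∀ k, |f (d (k + 1)) - f (d k)| ≤ M * r ^ (k + 1) := by
    intro k
    -- Hence consecutive dyadic approximations of `t` agree or differ by one step of level `k + 1`.
    have hhalf : ⌊2 ^ k * t⌋₊ = ⌊2 ^ (k + 1) * t⌋₊ / 2 := by
      rw [← Nat.floor_div_natCast]
      congr 1
      rw [pow_succ]
      push_cast
      ring
    have hle : ⌊2 ^ (k + 1) * t⌋₊ ≤ 2 ^ (k + 1) := by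
      refine Nat.floor_le_of_le ?_
      push_cast
      have : (0 : ℝ) < 2 ^ (k + 1) := by positivity
      nlinarith
    simp only [d, hhalf]
    generalize ⌊2 ^ (k + 1) * t⌋₊ = m at hle
    rcases Nat.even_or_odd' m with ⟨j, rfl | rfl⟩
    · rw [Nat.mul_div_cancel_left _ two_pos]
      have : ((2 * j : ℕ) : ℝ) / 2 ^ (k + 1) = j / 2 ^ k := by
        push_cast; rw [pow_succ]; field_simp
      rw [this, sub_self, abs_zero]
      positivity
    · have e : (2 * j + 1) / 2 = j := by omega
      have : (j : ℝ) / 2 ^ k = ((2 * j : ℕ) : ℝ) / 2 ^ (k + 1) := by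
        push_cast; rw [pow_succ]; field_simp
      rw [e, this]
      simpa using h (k + 1) (2 * j) (by omega)
  have hsum : ∀ k, |f (d k) - f (d 0)| ≤ M * ∑ i ∈ Finset.range (k + 1), r ^ i := by
    intro k
    induction k with
    | zero => simpa using hM
    | succ k ih =>
      rw [Finset.sum_range_succ, mul_add]
      have := abs_sub_le (f (d (k + 1))) (f (d k)) (f (d 0))
      linarith [hstep k]
  have hgeom : ∀ k, ∑ i ∈ Finset.range k, r ^ i ≤ (1 - r)⁻¹ := fun k => by
    rw [← tsum_geometric_of_lt_one hr0 hr1]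
    exact (summable_geometric_of_lt_one hr0 hr1).sum_le_tsum _ fun i _ => by positivity
  -- `d 0` is `0`, or `1` when `t = 1`; this costs the extra `M` in the bound.
  have hd0 : |f (d 0) - f 0| ≤ M := by
    have hle : ⌊t⌋₊ ≤ 1 := Nat.floor_le_of_le (by simpa using ht1)
    simp only [d, pow_zero, one_mul, div_one]
    interval_cases ⌊t⌋₊
    · simpa using hM
    · simpa using h 0 0 (by simp)
  have hlim : Tendsto (fun k => |f (d k) - f (d 0)|) atTop (𝓝 |f t - f (d 0)|) :=
    (((hf.tendsto t).comp hd).sub_const _).abs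
  have hbound := le_of_tendsto' hlim fun k =>
    (hsum k).trans (mul_le_mul_of_nonneg_left (hgeom _) hM)
  have := abs_sub_le (f t) (f (d 0)) (f 0)
  linarith

/-- Sublinear growth of a path whose values at the integers and whose dyadic increments grow
sublinearly. -/
theorem tendsto_div_of_dyadic_increments {g : ℝ → ℝ} (hg : Continuous g) {M : ℕ → ℝ} {r : ℝ}
    (hM0 : ∀ n, 0 ≤ M n) (hM : Tendsto M atTop (𝓝 0)) (hr0 : 0 ≤ r) (hr1 : r < 1)
    (hint : ∀ n : ℕ, |g n| ≤ (n + 1) * M n)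
    (hinc : ∀ n k j : ℕ, j < 2 ^ k →
      |g (n + (j + 1) / 2 ^ k) - g (n + j / 2 ^ k)| ≤ (n + 1) * r ^ k * M n) :
    Tendsto (fun t => g t / t) atTop (𝓝 0) := by
  have h1 : 0 < 1 - r := by linarith
  -- The factor `2` comes from `n + 1 ≤ 2 * t`; the rest adds the bound at the integer `n` to the
  -- chaining bound.
  set C := 2 * (2 + (1 - r)⁻¹)
  have hlim : Tendsto (fun t : ℝ => C * M ⌊t⌋₊) atTop (𝓝 0) := by
    simpa using (hM.comp (tendsto_nat_floor_atTop (α := ℝ))).const_mul C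
  refine squeeze_zero_norm' ?_ hlim
  filter_upwards [eventually_ge_atTop 1] with t ht
  have hn1 : (1 : ℝ) ≤ ⌊t⌋₊ := by exact_mod_cast (Nat.one_le_floor_iff t).2 ht
  have hn := Nat.floor_le (zero_le_one.trans ht)
  have hn' := (Nat.lt_floor_add_one t).le
  generalize ⌊t⌋₊ = n at hn1 hn hn'
  have hM0n := hM0 n
  have hchain := abs_sub_le_of_dyadic_increments (f := fun s => g (n + s)) (by fun_prop)
    (M := (n + 1) * M n) (by positivity) hr0 hr1
    (fun k j hj => (hinc n k j hj).trans_eq (by ring)) (t := t - n) (by linarith) (by linarith)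
  simp only [add_sub_cancel, add_zero] at hchain
  have hgt : |g t| ≤ (n + 1) * M n * (2 + (1 - r)⁻¹) := by
    have h2 : |g t| ≤ |g t - g n| + |g n| := by simpa using abs_add_le (g t - g n) (g n)
    linarith [hint n]
  rw [Real.norm_eq_abs, abs_div, abs_of_pos (by linarith : 0 < t), div_le_iff₀ (by linarith)]
  have hi : 0 ≤ (1 - r)⁻¹ := by positivity
  calc |g t| ≤ (n + 1) * M n * (2 + (1 - r)⁻¹) := hgt
    _ ≤ (2 * t) * M n * (2 + (1 - r)⁻¹) := by gcongr; linarith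
    _ = C * M n * t := by ring

theorem abs_le_mul_rpow_of_enorm_div_pow_le {a b : ℝ} (hb : 0 < b) {p : ℕ} (hp : p ≠ 0) {W : ℝ≥0∞}
    (hW : W ≠ ∞) (h : (‖a‖ₑ / ENNReal.ofReal b) ^ p ≤ W) :
    |a| ≤ b * W.toReal ^ ((p : ℝ)⁻¹) := by
  rw [Real.enorm_eq_ofReal_abs, ← ENNReal.ofReal_div_of_pos hb,
    ← ENNReal.ofReal_pow (by positivity)] at h
  have h1 := ENNReal.toReal_mono hW h
  rw [ENNReal.toReal_ofReal (by positivity)] at h1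
  have h2 := Real.rpow_le_rpow (by positivity) h1 (by positivity : (0 : ℝ) ≤ (p : ℝ)⁻¹)
  rw [Real.pow_rpow_inv_natCast (by positivity) hp, div_le_iff₀ hb] at h2
  linarith

theorem lintegral_enorm_div_pow_le {Z : Ω → ℝ} {p : ℕ} {K : ℝ≥0∞} {a b : ℝ}
    (hb : 0 < b) (h : ∫⁻ ω, ‖Z ω‖ₑ ^ p ∂P ≤ K * ENNReal.ofReal a ^ p) :
    ∫⁻ ω, (‖Z ω‖ₑ / ENNReal.ofReal b) ^ p ∂P ≤ K * ENNReal.ofReal (a / b) ^ p := by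
  have hb' : (ENNReal.ofReal b)⁻¹ ^ p ≠ ∞ := by simp [hb]
  simp_rw [div_eq_mul_inv (‖Z _‖ₑ), mul_pow]
  rw [lintegral_mul_const' _ _ hb', ENNReal.ofReal_div_of_pos hb, div_eq_mul_inv, mul_pow,
    ← mul_assoc]
  gcongr

/-- A process with continuous paths whose increments satisfy Kolmogorov's moment condition with an
exponent `γ < 1` grows sublinearly. -/
theorem ae_tendsto_div_of_moment_bound {G : ℝ≥0 → Ω → ℝ} (hm : ∀ t, AEMeasurable (G t) P)
    (hcont : ∀ᵐ ω ∂P, Continuous fun t => G t ω) (hzero : ∀ᵐ ω ∂P, G 0 ω = 0)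
    {γ : ℝ} (hγ : 0 < γ) {p : ℕ} (hp : 2 < γ * p) (hp' : 1 < (1 - γ) * p) {K : ℝ≥0∞}
    (hK : K ≠ ∞)
    (hmom : ∀ s t : ℝ≥0, ∫⁻ ω, ‖G t ω - G s ω‖ₑ ^ p ∂P ≤
      K * ENNReal.ofReal (|(t : ℝ) - s| ^ γ) ^ p) :
    ∀ᵐ ω ∂P, Tendsto (fun t : ℝ => G t.toNNReal ω / t) atTop (𝓝 0) := by
  have hp0 : p ≠ 0 := by rintro rfl; norm_num at hp
  -- Half of the exponent `γ` goes into the path bound `r ^ k`, half into convergence: the `2 ^ k`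
  -- normalized increments of level `k` have `p`-th moments summing to a multiple of `(2 * r ^ p) ^
  -- k`, and `2 * r ^ p < 1` because `γ * p > 2`.
  obtain ⟨r, hr⟩ : ∃ r : ℝ, r = 2 ^ (-(γ / 2)) := ⟨_, rfl⟩
  have hr0 : 0 < r := by rw [hr]; positivity
  have hr1 : r < 1 := by
    rw [hr]; exact Real.rpow_lt_one_of_one_lt_of_neg one_lt_two (by linarith)
  have hrp : 2 * r ^ p < 1 := by
    have : 2 * r ^ p = 2 ^ (1 - γ * p / 2) := by
      rw [hr, ← Real.rpow_mul_natCast zero_le_two, Real.rpow_sub two_pos, Real.rpow_one,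
        neg_mul, Real.rpow_neg zero_le_two, div_eq_mul_inv]
      ring_nf
    rw [this]
    exact Real.rpow_lt_one_of_one_lt_of_neg one_lt_two (by linarith)
  have hrk : ∀ k : ℕ, ((1 : ℝ) / 2 ^ k) ^ γ = r ^ k * r ^ k := by
    intro k
    have h2 : r * r = 2 ^ (-γ) := by
      rw [hr, ← Real.rpow_add two_pos]; ring_nf
    rw [← mul_pow, h2, ← Real.rpow_mul_natCast zero_le_two, one_div, ← Real.rpow_natCast,
      ← Real.rpow_neg zero_le_two, ← Real.rpow_mul zero_le_two]
    ring_nf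
  let τ : ℕ → ℕ → ℕ → ℝ≥0 := fun n k j => n + j / 2 ^ k
  let a : ℕ → ℕ → ℕ → Ω → ℝ≥0∞ := fun n k j ω =>
    (‖G (τ n k (j + 1)) ω - G (τ n k j) ω‖ₑ / ENNReal.ofReal ((n + 1) * r ^ k)) ^ p
  let b : ℕ → Ω → ℝ≥0∞ := fun n ω => (‖G n ω - G 0 ω‖ₑ / ENNReal.ofReal (n + 1)) ^ p
  -- One variable bounds the value at `n` and all dyadic increments on `[n, n+1]`, each normalized
  -- by its target size.
  let W : ℕ → Ω → ℝ≥0∞ := fun n ω => b n ω + ∑' k, ∑ j ∈ Finset.range (2 ^ k), a n k j ω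
  have ham : ∀ n k j, AEMeasurable (a n k j) P := fun n k j =>
    (((hm _).sub (hm _)).enorm.div_const _).pow_const _
  have hbm : ∀ n, AEMeasurable (b n) P := fun n =>
    (((hm _).sub (hm _)).enorm.div_const _).pow_const _
  have hsm : ∀ n k, AEMeasurable (fun ω => ∑ j ∈ Finset.range (2 ^ k), a n k j ω) P :=
    fun n k => Finset.aemeasurable_fun_sum _ fun j _ => ham n k j
  have hWm : ∀ n, AEMeasurable (W n) P := fun n =>
    (hbm n).add (AEMeasurable.tsum fun k => hsm n k)
  -- This is `(n + 1) ^ ((γ - 1) * p)`, summable because `(1 - γ) * p > 1`.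
  let e : ℕ → ℝ≥0∞ := fun n => ENNReal.ofReal (((n : ℝ) + 1) ^ (γ - 1)) ^ p
  have hrw : ∀ n : ℕ, ((n : ℝ) + 1) ^ (γ - 1) = ((n : ℝ) + 1) ^ γ / (n + 1) := fun n => by
    rw [Real.rpow_sub (by positivity), Real.rpow_one]
  have hb : ∀ n, ∫⁻ ω, b n ω ∂P ≤ K * e n := by
    intro n
    refine (lintegral_enorm_div_pow_le (by positivity) (hmom 0 n)).trans ?_
    simp only [e, hrw]
    gcongr
    simp
  have ha : ∀ n k j, ∫⁻ ω, a n k j ω ∂P ≤ K * (e n * ENNReal.ofReal (r ^ k) ^ p) := by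
    intro n k j
    refine (lintegral_enorm_div_pow_le (by positivity) (hmom _ _)).trans ?_
    have hτ : |((τ n k (j + 1) : ℝ≥0) : ℝ) - τ n k j| = 1 / 2 ^ k := by
      simp only [τ]
      push_cast
      rw [show (n : ℝ) + (j + 1) / 2 ^ k - (n + j / 2 ^ k) = 1 / 2 ^ k by ring]
      exact abs_of_nonneg (by positivity)
    rw [hτ, hrk]
    simp only [e]
    rw [← mul_pow (ENNReal.ofReal _), ← ENNReal.ofReal_mul (by positivity), hrw]
    gcongr
    rw [mul_div_mul_right _ _ (by positivity), div_mul_eq_mul_div]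
    gcongr
    -- The natural factor `1 / (n + 1)` is weakened to `(n + 1) ^ (γ - 1)`, the rate already needed
    -- for `b n`.
    refine le_mul_of_one_le_left (by positivity) (Real.one_le_rpow (by simp) hγ.le)
  set K' := K * (1 + (1 - ENNReal.ofReal (2 * r ^ p))⁻¹)
  have hK' : K' ≠ ∞ := by
    refine ENNReal.mul_ne_top hK (ENNReal.add_ne_top.2 ⟨by simp, ?_⟩)
    rw [ENNReal.inv_ne_top]
    exact (tsub_pos_of_lt (ENNReal.ofReal_lt_one.2 hrp)).ne'
  have hW : ∀ n, ∫⁻ ω, W n ω ∂P ≤ K' * e n := by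
    intro n
    have hk : ∀ k, ∫⁻ ω, ∑ j ∈ Finset.range (2 ^ k), a n k j ω ∂P ≤
        K * e n * ENNReal.ofReal (2 * r ^ p) ^ k := by
      intro k
      rw [lintegral_finsetSum' _ fun j _ => ham n k j]
      refine (Finset.sum_le_sum fun j _ => ha n k j).trans_eq ?_
      rw [Finset.sum_const, Finset.card_range, nsmul_eq_mul,
        ENNReal.ofReal_mul zero_le_two, ENNReal.ofReal_pow hr0.le, ENNReal.ofReal_pow hr0.le]
      push_cast
      rw [ENNReal.ofReal_ofNat]
      ring
    calc ∫⁻ ω, W n ω ∂P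
        = ∫⁻ ω, b n ω ∂P + ∑' k, ∫⁻ ω, ∑ j ∈ Finset.range (2 ^ k), a n k j ω ∂P := by
          rw [lintegral_add_left' (hbm n), lintegral_tsum fun k => hsm n k]
      _ ≤ K * e n + ∑' k, K * e n * ENNReal.ofReal (2 * r ^ p) ^ k :=
          add_le_add (hb n) (ENNReal.tsum_le_tsum hk)
      _ = K' * e n := by
          rw [ENNReal.tsum_mul_left, ENNReal.tsum_geometric]
          ring
  have he : ∑' n, e n ≠ ∞ := by
    have hs : Summable fun n : ℕ => ((n : ℝ) + 1) ^ ((γ - 1) * p) := by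
      have := (summable_nat_add_iff 1).2
        (Real.summable_nat_rpow (p := (γ - 1) * p) |>.2 (by linarith))
      simpa using this
    have hsum := hs.tsum_ofReal_ne_top
    convert hsum using 4 with n
    simp only [e]
    rw [← ENNReal.ofReal_pow (by positivity), Real.rpow_mul_natCast (by positivity)]
  have hfin : ∀ᵐ ω ∂P, ∑' n, W n ω < ∞ := by
    refine ae_lt_top' (AEMeasurable.tsum hWm) ?_
    rw [lintegral_tsum hWm]
    refine ne_top_of_le_ne_top (ENNReal.mul_ne_top hK' he) ?_
    rw [← ENNReal.tsum_mul_left]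
    exact ENNReal.tsum_le_tsum hW
  filter_upwards [hfin, hcont, hzero] with ω hω hc h0
  have hWfin : ∀ n, W n ω ≠ ∞ := fun n => ne_top_of_le_ne_top hω.ne (ENNReal.le_tsum n)
  have hWlim : Tendsto (fun n => (W n ω).toReal ^ ((p : ℝ)⁻¹)) atTop (𝓝 0) := by
    have h1 : Tendsto (fun n => (W n ω).toReal) atTop (𝓝 0) := by
      exact (ENNReal.tendsto_toReal ENNReal.zero_ne_top).comp
        (ENNReal.tendsto_atTop_zero_of_tsum_ne_top hω.ne)
    have hp1 : (0 : ℝ) < (p : ℝ)⁻¹ := by positivity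
    have := h1.rpow_const (p := (p : ℝ)⁻¹) (Or.inr hp1.le)
    rwa [Real.zero_rpow hp1.ne'] at this
  refine tendsto_div_of_dyadic_increments (g := fun t => G t.toNNReal ω)
    (hc.comp continuous_real_toNNReal) (fun n => by positivity) hWlim hr0.le hr1 ?_ ?_
  · intro n
    have hbW : b n ω ≤ W n ω := le_self_add
    simp only [b, h0, sub_zero] at hbW
    simpa using abs_le_mul_rpow_of_enorm_div_pow_le (by positivity) hp0 (hWfin n) hbW
  · intro n k j hj
    have haW : a n k j ω ≤ W n ω :=
      ((Finset.single_le_sum (f := fun j => a n k j ω) (fun _ _ => zero_le)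
        (Finset.mem_range.2 hj)).trans
        (ENNReal.le_tsum (f := fun k => ∑ j ∈ Finset.range (2 ^ k), a n k j ω) k)).trans
        le_add_self
    have e1 : ((n : ℝ) + (j + 1) / 2 ^ k).toNNReal = τ n k (j + 1) := by
      ext; rw [Real.coe_toNNReal _ (by positivity)]; simp [τ]
    have e2 : ((n : ℝ) + j / 2 ^ k).toNNReal = τ n k j := by
      ext; rw [Real.coe_toNNReal _ (by positivity)]; simp [τ]
    simp only [e1, e2]
    exact abs_le_mul_rpow_of_enorm_div_pow_le (by positivity) hp0 (hWfin n) haW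

end Vasicek

/-! ### Growth of `G` and the law of `ζ_∞` -/

namespace Vasicek

open Set
open scoped ENNReal

variable {Ω : Type*} [MeasurableSpace Ω] {P : Measure Ω} {G : ℝ≥0 → Ω → ℝ}

namespace AssumptionA1

theorem exists_map_sum_eq_gaussianReal (hG : AssumptionA1 G P) (c : ℕ → ℝ) (t : ℕ → ℝ≥0) (m : ℕ) :
    AEMeasurable (fun ω => ∑ k ∈ Finset.range m, c k * G (t k) ω) P ∧
    ∃ v : ℝ≥0, P.map (fun ω => ∑ k ∈ Finset.range m, c k * G (t k) ω) = gaussianReal 0 v := by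
  have h := ((hG.gaussian.comp_right t).smul c).hasGaussianLaw_fun_sum (I := Finset.range m)
  simp only [Function.comp, smul_eq_mul] at h
  have h0 : ∫ ω, ∑ k ∈ Finset.range m, c k * G (t k) ω ∂P = 0 := by
    rw [integral_finsetSum _ fun k _ =>
      (hG.gaussian.hasGaussianLaw_eval (t k)).integrable.const_mul (c k)]
    simp_rw [integral_const_mul, hG.centered, mul_zero, Finset.sum_const_zero]
  have hmap := h.map_eq_gaussianReal
  rw [h0] at hmap
  exact ⟨h.aemeasurable, _, hmap⟩

theorem ae_tendsto_div (hG : AssumptionA1 G P) (hcont : ∀ᵐ ω ∂P, Continuous fun t => G t ω) :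
    ∀ᵐ ω ∂P, Tendsto (fun t : ℝ => G t.toNNReal ω / t) atTop (𝓝 0) := by
  obtain ⟨c, γ, hc, hγ0, hγ1, hinc⟩ := hG.increments
  obtain ⟨p, hp⟩ := exists_nat_gt (max (2 / γ) (1 / (1 - γ)))
  have hp1 := (le_max_left _ _).trans_lt hp
  have hp2 := (le_max_right _ _).trans_lt hp
  rw [div_lt_iff₀' hγ0] at hp1
  rw [div_lt_iff₀' (by linarith)] at hp2
  refine ae_tendsto_div_of_moment_bound (fun t => hG.gaussian.aemeasurable t) hcont hG.zero hγ0
    hp1 hp2 (K := ENNReal.ofReal √c ^ p * ∫⁻ x, ‖x‖ₑ ^ p ∂(gaussianReal 0 1))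
    (ENNReal.mul_ne_top (by simp) (lintegral_enorm_pow_gaussianReal_lt_top p).ne) fun s t => ?_
  have h := lintegral_enorm_pow_le_of_hasGaussianLaw
    (hG.gaussian.hasGaussianLaw_fun_sub (s := t) (t := s)) ?_
    (s := √c * |(t : ℝ) - s| ^ γ) (by positivity) ?_ p
  · refine h.trans_eq ?_
    rw [ENNReal.ofReal_mul (by positivity), mul_pow]
    ring
  · rw [integral_sub (hG.gaussian.hasGaussianLaw_eval t).integrable
      (hG.gaussian.hasGaussianLaw_eval s).integrable, hG.centered, hG.centered, sub_zero]
  · refine (hinc s t).trans_eq ?_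
    rw [mul_pow, Real.sq_sqrt hc.le, ← Real.rpow_mul_natCast (abs_nonneg _), mul_comm γ]
    norm_num

/-- Closure under almost sure limits is used twice: for Riemann sums on `[0, N]`, then for `N → ∞`,
where sublinear growth gives integrability. -/
theorem exists_map_zetaInfty_eq_gaussianReal [IsProbabilityMeasure P] (hG : AssumptionA1 G P)
    (hcont : ∀ᵐ ω ∂P, Continuous fun t => G t ω) {θ : ℝ} (hθ : 0 < θ) :
    AEMeasurable (fun ω => zetaInfty θ fun t => G t ω) P ∧
    ∃ v : ℝ≥0, P.map (fun ω => zetaInfty θ fun t => G t ω) = gaussianReal 0 v := by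
  have hfinite : ∀ N : ℕ,
      AEMeasurable (fun ω => ∫ s in (0 : ℝ)..N, θ * (Real.exp (-θ * s) * G s.toNNReal ω)) P ∧
      ∃ v : ℝ≥0, P.map (fun ω => ∫ s in (0 : ℝ)..N, θ * (Real.exp (-θ * s) * G s.toNNReal ω)) =
        gaussianReal 0 v := by
    intro N
    have h := fun m : ℕ => hG.exists_map_sum_eq_gaussianReal
      (fun k => N / m * (θ * Real.exp (-θ * (k * (N / m))))) (fun k => (k * (N / m) : ℝ).toNNReal) m
    refine exists_map_eq_gaussianReal_of_tendsto (fun m => (h m).1) (fun m => (h m).2) ?_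
    filter_upwards [hcont] with ω hω
    have hc : Continuous fun s : ℝ => G s.toNNReal ω := hω.comp continuous_real_toNNReal
    refine (tendsto_riemann_sum (f := fun s => θ * (Real.exp (-θ * s) * G s.toNNReal ω))
      (by fun_prop) N.cast_nonneg).congr fun m => ?_
    refine Finset.sum_congr rfl fun k _ => ?_
    ring
  refine exists_map_eq_gaussianReal_of_tendsto (fun N => (hfinite N).1) (fun N => (hfinite N).2) ?_
  filter_upwards [hcont, hG.ae_tendsto_div hcont] with ω hω hgrowth
  have hc : Continuous fun s : ℝ => G s.toNNReal ω := hω.comp continuous_real_toNNReal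
  have hO : (fun s : ℝ => G s.toNNReal ω) =O[atTop] fun t => t :=
    ((Asymptotics.isLittleO_iff_tendsto' ((eventually_gt_atTop 0).mono
      fun _ ht h0 => absurd h0 ht.ne')).2 hgrowth).isBigO
  rw [zetaInfty, ← integral_const_mul]
  exact intervalIntegral_tendsto_integral_Ioi 0 ((integrableOn_exp_neg_mul hc hO hθ).const_mul θ)
    tendsto_natCast_atTop_atTop

/-- With positive variance `ζ_∞` does not charge the point `-μ`; with zero variance it vanishes
almost surely, and nondegeneracy gives `μ ≠ 0`. -/
theorem ae_add_zetaInfty_ne_zero [IsProbabilityMeasure P] (hG : AssumptionA1 G P)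
    (hcont : ∀ᵐ ω ∂P, Continuous fun t => G t ω) {θ μ : ℝ} (hθ : 0 < θ)
    (hnd : ¬ (μ = 0 ∧ ∀ᵐ ω ∂P, zetaInfty θ (fun t => G t ω) = 0)) :
    ∀ᵐ ω ∂P, μ + zetaInfty θ (fun t => G t ω) ≠ 0 := by
  obtain ⟨hm, v, hv⟩ := hG.exists_map_zetaInfty_eq_gaussianReal hcont hθ
  rcases eq_or_ne v 0 with rfl | hv0
  · rw [gaussianReal_zero_var] at hv
    have h0 : ∀ᵐ ω ∂P, zetaInfty θ (fun t => G t ω) = 0 := by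
      refine ae_of_ae_map (p := fun x => x = 0) hm ?_
      rw [hv, ae_dirac_eq]
      rfl
    filter_upwards [h0] with ω hω
    rw [hω, add_zero]
    exact fun hμ => hnd ⟨hμ, h0⟩
  · have := nullSingletonClass_gaussianReal (μ := 0) hv0
    refine ae_of_ae_map (p := fun x => μ + x ≠ 0) hm ?_
    rw [hv]
    filter_upwards [(measure_eq_zero_iff_ae_notMem).1
      (measure_singleton (μ := gaussianReal 0 v) (-μ))] with x hx h
    exact hx (by simp only [mem_singleton_iff]; linarith)

end AssumptionA1

end Vasicek

/-- Strong consistency of `θ̃_T`, `μ̃_T` and `α̃_T` for the non-ergodic Gaussian Vasicek model. -/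
theorem mainTheorem1 {Ω : Type*} [MeasurableSpace Ω] (P : Measure Ω) [IsProbabilityMeasure P]
    (G X : ℝ≥0 → Ω → ℝ) (θ μ : ℝ) (hθ : 0 < θ)
    (hG : Vasicek.AssumptionA1 G P)
    (hcont : ∀ᵐ ω ∂P, Continuous fun t => G t ω)
    (hX : ∀ᵐ ω ∂P, Vasicek.IsSolution θ μ (fun t => G t ω) (fun t => X t ω))
    (hnd : ¬ (μ = 0 ∧ ∀ᵐ ω ∂P, Vasicek.zetaInfty θ (fun t => G t ω) = 0)) :
    (∀ᵐ ω ∂P, ∀ᶠ T in atTop, Vasicek.denomTheta (fun t => X t ω) T ≠ 0 ∧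
      Vasicek.denomMu (fun t => X t ω) T ≠ 0) ∧
    (∀ᵐ ω ∂P, Tendsto (Vasicek.thetaTilde fun t => X t ω) atTop (𝓝 θ)) ∧
    (∀ᵐ ω ∂P, Tendsto (Vasicek.muTilde fun t => X t ω) atTop (𝓝 μ)) ∧
    (∀ᵐ ω ∂P, ∀ᶠ T in atTop, Vasicek.alphaTilde (fun t => X t ω) T =
      Vasicek.thetaTilde (fun t => X t ω) T * Vasicek.muTilde (fun t => X t ω) T) ∧
    (∀ᵐ ω ∂P, Tendsto (Vasicek.alphaTilde fun t => X t ω) atTop (𝓝 (θ * μ))) := by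
  have main : ∀ᵐ ω ∂P,
      (∀ᶠ T in atTop, Vasicek.denomTheta (fun t => X t ω) T ≠ 0 ∧
        Vasicek.denomMu (fun t => X t ω) T ≠ 0) ∧
      Tendsto (Vasicek.thetaTilde fun t => X t ω) atTop (𝓝 θ) ∧
      Tendsto (Vasicek.muTilde fun t => X t ω) atTop (𝓝 μ) := by
    filter_upwards [hcont, hX, hG.ae_tendsto_div hcont,
      hG.ae_add_zetaInfty_ne_zero hcont hθ hnd] with ω hc hx hgrowth hL
    exact hx.consistent hθ hc hgrowth hL
  have hα : ∀ᵐ ω ∂P, ∀ᶠ T in atTop, Vasicek.alphaTilde (fun t => X t ω) T =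
      Vasicek.thetaTilde (fun t => X t ω) T * Vasicek.muTilde (fun t => X t ω) T :=
    main.mono fun ω h => h.1.mono fun T hT => Vasicek.alphaTilde_eq hT.2
  refine ⟨main.mono fun ω h => h.1, main.mono fun ω h => h.2.1, main.mono fun ω h => h.2.2, hα, ?_⟩
  filter_upwards [main, hα] with ω h hω
  exact (h.2.1.mul h.2.2).congr' (hω.mono fun T hT => hT.symm)
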